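/- Let $d\in\{2,3\}$ and let $\Omega\subset\mathbb R^d$ be a bounded domain (open and connected) with Lipschitz boundary; write $(\cdot,\cdot)$ and $\|\cdot\|$ for the $L^2(\Omega)$ inner product and norm. Let $V$ be one of the following spaces: (i) $V=[H^1_D(\Omega)]^d$, the fields in $[H^1(\Omega)]^d$ with vanishing trace on $\Gamma_D$, for a closed set $\Gamma_D\subset\partial\Omega$ of nonzero $(d-1)$-dimensional measure; (ii) $V$ is the space of the fields in $[H^1(\Omega)]^d$ that are $L^2$-orthogonal to all rigid body motions $x\mapsto c+\mathfrak m x$, $\mathfrak m^\top=-\mathfrak m$; (iii) $\Omega=(0,1)^d$ and $V$ is the space of the periodic $H^1$ vector fields of mean zero. For $u,v\in V$ and $q\in L^2(\Omega)$ put $\varepsilon(v)=\frac12(\nabla v+\nabla v^\top)$, $a(u,v)=(\varepsilon(u),\varepsilon(v))$ and $b(v,q)=(\operatorname{div}v,q)$. Let $\beta>0$. There is a constant $C>0$, depending only on $\Omega$ and $\beta$, such that the following holds for each such $V$ and for all finite-dimensional subspaces $V_h\subset V$, $Q_h\subset L^2(\Omega)$ that satisfy the discrete inf-sup condition $$\inf_{0\ne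 q_h\in Q_h}\ \sup_{0\ne v_h\in V_h}\frac{(\operatorname{div}v_h,q_h)}{\|\nabla v_h\|\,\|q_h\|}\ \ge\ \beta .$$ Let $\Pi_h$ be the $L^2$-orthogonal projection onto $Q_h$, and define $A^h_\lambda:V_h\to V_h'$ by $$\langle A^h_\lambda u_h,v_h\rangle=a(u_h,v_h)+\lambda\, b(v_h,\Pi_h\operatorname{div}u_h),\qquad u_h,v_h\in V_h,$$ so that $\langle A^h_\lambda u_h,v_h\rangle=a(u_h,v_h)+\lambda\,b(v_h,\operatorname{div}u_h)$ if $\operatorname{div}V_h\subset Q_h$. Let $A_h=A^h_0$ and $W_h=\{v_h\in V_h: b(v_h,q_h)=0\ \ \forall q_h\in Q_h\}$. Then: 1. $A^h_\lambda$ is bijective for every $\lambda\ge0$, and there is exactly one $a$-orthogonal projection $P_h:V_h\to W_h$, that is, exactly one linear map with $a(P_hv_h,w_h)=a(v_h,w_h)$ for all $v_h\in V_h$ and $w_h\in W_h$. 2. With $$M^h_\lambda:=\frac{\lambda}{1+\lambda}P_hA_h^{-1}+\frac1{1+\lambda}A_h^{-1}:V_h'\to V_h$$ one has, for every $\lambda\ge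 0$ and every $g\in V_h'$, $$\langle g,(A^h_\lambda)^{-1}g\rangle\le C\,\langle g,M^h_\lambda g\rangle\quad\text{and}\quad \langle g,M^h_\lambda g\rangle\le C\,\langle g,(A^h_\lambda)^{-1}g\rangle .$$ 3. For every $v_h\in V_h$, the discrete Stokes problem of finding $(v_0,p_h)\in V_h\times Q_h$ such that $$a(v_0,w_h)+b(w_h,p_h)=a(v_h,w_h)\quad\forall w_h\in V_h,\qquad b(v_0,q_h)=0\quad\forall q_h\in Q_h,$$ has exactly one solution, and its velocity is $v_0=P_hv_h$. -/

import Mathlib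

open MeasureTheory Set Filter Topology

noncomputable section

namespace Elasticity

variable {d : ℕ}

/-- Euclidean space `ℝ^d`. -/
abbrev Pt (d : ℕ) : Type := EuclideanSpace ℝ (Fin d)

/-- The real Hilbert space `L²(Ω)`. -/
abbrev L2 (Ω : Set (Pt d)) : Type := Lp ℝ 2 ((volume : Measure (Pt d)).restrict Ω)

/-- The classical partial derivative `∂φ/∂x_j`. -/
def pderiv (j : Fin d) (φ : Pt d → ℝ) (x : Pt d) : ℝ :=
  fderiv ℝ φ x (EuclideanSpace.single j 1)

/-- `φ ∈ C_c^∞(Ω)`. -/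
def IsTestFunction (Ω : Set (Pt d)) (φ : Pt d → ℝ) : Prop :=
  ContDiff ℝ (⊤ : ℕ∞) φ ∧ HasCompactSupport φ ∧ tsupport φ ⊆ Ω

/-- `Ω` is a bounded domain (open, connected, nonempty) with Lipschitz boundary: near each boundary
point, in suitable orthonormal coordinates whose last axis is spanned by `e`, the set `Ω` is the
region below the graph of a Lipschitz function of the remaining coordinates. -/
structure IsLipschitzDomain (Ω : Set (Pt d)) : Prop where
  isOpen : IsOpen Ω
  isConnected : IsConnected Ω
  isBounded : Bornology.IsBounded Ω
  lipschitz_boundary : ∀ x ∈ frontier Ω, ∃ e : Pt d, ‖e‖ = 1 ∧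
    ∃ (K : NNReal) (g : Pt d → ℝ), LipschitzWith K g ∧
      ∃ r : ℝ, 0 < r ∧ ∀ y ∈ Metric.ball x r,
        (y ∈ Ω ↔ inner ℝ e y < g (y - inner ℝ e y • e))

theorem integrable_mul_L2 {Ω : Set (Pt d)} (u : L2 Ω) {f : Pt d → ℝ}
    (hf : MemLp f 2 ((volume : Measure (Pt d)).restrict Ω)) :
    Integrable (fun x => u x * f x) ((volume : Measure (Pt d)).restrict Ω) :=
  MemLp.integrable_mul (Lp.memLp u) hf

theorem integral_add_mul_L2 {Ω : Set (Pt d)} (u v : L2 Ω) {f : Pt d → ℝ}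
    (hf : MemLp f 2 ((volume : Measure (Pt d)).restrict Ω)) :
    ∫ x in Ω, (u + v : L2 Ω) x * f x = (∫ x in Ω, u x * f x) + ∫ x in Ω, v x * f x := by
  rw [← integral_add (integrable_mul_L2 u hf) (integrable_mul_L2 v hf)]
  refine integral_congr_ae ?_
  filter_upwards [Lp.coeFn_add u v] with x hx
  rw [hx, Pi.add_apply, add_mul]

theorem integral_smul_mul_L2 {Ω : Set (Pt d)} (c : ℝ) (u : L2 Ω) (f : Pt d → ℝ) :
    ∫ x in Ω, (c • u : L2 Ω) x * f x = c * ∫ x in Ω, u x * f x := by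
  rw [← integral_const_mul]
  refine integral_congr_ae ?_
  filter_upwards [Lp.coeFn_smul c u] with x hx
  rw [hx, Pi.smul_apply, smul_eq_mul, mul_assoc]

theorem integral_zero_mul_L2 {Ω : Set (Pt d)} (f : Pt d → ℝ) :
    ∫ x in Ω, (0 : L2 Ω) x * f x = 0 := by
  simpa using integral_smul_mul_L2 0 (0 : L2 Ω) f

theorem continuous_pderiv (j : Fin d) {φ : Pt d → ℝ} (hφ : ContDiff ℝ (⊤ : ℕ∞) φ) :
    Continuous (pderiv j φ) :=
  (hφ.continuous_fderiv (by simp)).clm_apply continuous_const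

theorem memLp_testFunction {Ω : Set (Pt d)} {φ : Pt d → ℝ} (hφ : IsTestFunction Ω φ) :
    MemLp φ 2 ((volume : Measure (Pt d)).restrict Ω) :=
  (hφ.1.continuous.memLp_of_hasCompactSupport hφ.2.1).restrict Ω

theorem memLp_pderiv_testFunction {Ω : Set (Pt d)} {φ : Pt d → ℝ} (j : Fin d)
    (hφ : IsTestFunction Ω φ) :
    MemLp (pderiv j φ) 2 ((volume : Measure (Pt d)).restrict Ω) :=
  ((continuous_pderiv j hφ.1).memLp_of_hasCompactSupport
    (hφ.2.1.fderiv_apply (𝕜 := ℝ) (EuclideanSpace.single j 1))).restrict Ω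

/-- The Sobolev space `[H¹(Ω)]^d`. An element is a pair `(u, G)`, where `u ∈ [L²(Ω)]^d` and
`G i j ∈ L²(Ω)` is the weak derivative `∂u_i/∂x_j`; the weak gradient `G` is determined by `u`. -/
def H1 (Ω : Set (Pt d)) : Submodule ℝ ((Fin d → L2 Ω) × (Fin d → Fin d → L2 Ω)) where
  carrier := {w | ∀ i j : Fin d, ∀ φ : Pt d → ℝ, IsTestFunction Ω φ →
    ∫ x in Ω, w.1 i x * pderiv j φ x = -∫ x in Ω, w.2 i j x * φ x}
  add_mem' := by
    intro v w hv hw i j φ hφ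
    have h1 := hv i j φ hφ
    have h2 := hw i j φ hφ
    simp only [Prod.fst_add, Prod.snd_add, Pi.add_apply]
    rw [integral_add_mul_L2 _ _ (memLp_pderiv_testFunction j hφ),
      integral_add_mul_L2 _ _ (memLp_testFunction hφ), h1, h2]
    ring
  zero_mem' := by
    intro i j φ _
    simp only [Prod.fst_zero, Prod.snd_zero, Pi.zero_apply]
    rw [integral_zero_mul_L2, integral_zero_mul_L2, neg_zero]
  smul_mem' := by
    intro c v hv i j φ hφ
    have h1 := hv i j φ hφ
    simp only [Prod.smul_fst, Prod.smul_snd, Pi.smul_apply]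
    rw [integral_smul_mul_L2, integral_smul_mul_L2, h1]
    ring

section Forms

variable {Ω : Set (Pt d)}

/-- The component `v_i ∈ L²(Ω)` of a vector field. -/
def comp (i : Fin d) : H1 Ω →ₗ[ℝ] L2 Ω where
  toFun v := v.1.1 i
  map_add' _ _ := rfl
  map_smul' _ _ := rfl

/-- The weak partial derivative `∂v_i/∂x_j ∈ L²(Ω)`. -/
def grad (i j : Fin d) : H1 Ω →ₗ[ℝ] L2 Ω where
  toFun v := v.1.2 i j
  map_add' _ _ := rfl
  map_smul' _ _ := rfl

/-- The strain components `ε(v)_{ij} = (∂v_i/∂x_j + ∂v_j/∂x_i) / 2`. -/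
def strain (i j : Fin d) : H1 Ω →ₗ[ℝ] L2 Ω := (1 / 2 : ℝ) • (grad i j + grad j i)

/-- The divergence. -/
def divergence : H1 Ω →ₗ[ℝ] L2 Ω := ∑ i, grad i i

/-- `‖∇v‖`, the `L²` norm of the gradient. -/
def gradNorm (v : H1 Ω) : ℝ := √(∑ i, ∑ j, ‖grad i j v‖ ^ 2)

/-- `a(u, v) = (ε(u), ε(v))`. -/
def a : H1 Ω →ₗ[ℝ] H1 Ω →ₗ[ℝ] ℝ :=
  ∑ i, ∑ j, (innerₗ (L2 Ω)).compl₁₂ (strain i j) (strain i j)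

/-- `b(v, q) = (div v, q)`. -/
def b : H1 Ω →ₗ[ℝ] L2 Ω →ₗ[ℝ] ℝ := (innerₗ (L2 Ω)).comp divergence

end Forms

/-- Vanishing trace on `ΓD`. On a bounded Lipschitz domain the trace of `u` is the function on the
boundary with `⨍_{B(x,r) ∩ Ω} |u - (tr u)(x)| → 0` as `r → 0⁺` at almost every boundary point `x`
for the surface measure, i.e. the `(d-1)`-dimensional Hausdorff measure. -/
def HasZeroTraceOn {Ω : Set (Pt d)} (ΓD : Set (Pt d)) (u : L2 Ω) : Prop :=
  ∀ᵐ x ∂((Measure.hausdorffMeasure ((d : ℝ) - 1) : Measure (Pt d)).restrict ΓD),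
    Tendsto (fun r : ℝ => ⨍ y in Metric.ball x r ∩ Ω, |u y|) (𝓝[>] 0) (𝓝 0)

theorem integrableOn_abs_L2 {Ω : Set (Pt d)} (u : L2 Ω) (x : Pt d) (r : ℝ) :
    IntegrableOn (fun y => |u y|) (Metric.ball x r ∩ Ω) := by
  have h0 : (volume : Measure (Pt d)).restrict (Metric.ball x r ∩ Ω)
      = ((volume : Measure (Pt d)).restrict Ω).restrict (Metric.ball x r) := by
    rw [Measure.restrict_restrict measurableSet_ball]
  have h1 : MemLp u 2 ((volume : Measure (Pt d)).restrict (Metric.ball x r ∩ Ω)) := by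
    rw [h0]; exact (Lp.memLp u).restrict _
  have : IsFiniteMeasure ((volume : Measure (Pt d)).restrict (Metric.ball x r ∩ Ω)) :=
    ⟨by
      rw [Measure.restrict_apply_univ]
      exact (measure_mono inter_subset_left).trans_lt measure_ball_lt_top⟩
  exact (h1.integrable (by norm_num)).abs

theorem ae_ball_inter {Ω : Set (Pt d)} {p : Pt d → Prop} (x : Pt d) (r : ℝ)
    (h : ∀ᵐ y ∂((volume : Measure (Pt d)).restrict Ω), p y) :
    ∀ᵐ y ∂((volume : Measure (Pt d)).restrict (Metric.ball x r ∩ Ω)), p y :=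
  ae_mono (Measure.restrict_mono inter_subset_right le_rfl) h

theorem HasZeroTraceOn.add {Ω ΓD : Set (Pt d)} {u v : L2 Ω}
    (hu : HasZeroTraceOn ΓD u) (hv : HasZeroTraceOn ΓD v) : HasZeroTraceOn ΓD (u + v) := by
  filter_upwards [hu, hv] with x hx hy
  have hxy := hx.add hy
  rw [add_zero] at hxy
  refine squeeze_zero (fun r => ?_) (fun r => ?_) hxy
  · rw [setAverage_eq]
    exact smul_nonneg (by positivity) (integral_nonneg fun y => abs_nonneg _)
  · simp only [setAverage_eq, ← smul_add]
    refine smul_le_smul_of_nonneg_left ?_ (by positivity)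
    rw [← integral_add (integrableOn_abs_L2 u x r) (integrableOn_abs_L2 v x r)]
    refine integral_mono_ae (integrableOn_abs_L2 (u + v) x r)
      ((integrableOn_abs_L2 u x r).add (integrableOn_abs_L2 v x r)) ?_
    filter_upwards [ae_ball_inter x r (Lp.coeFn_add u v)] with y hy
    simp only [hy, Pi.add_apply]
    exact abs_add_le _ _

theorem HasZeroTraceOn.smul {Ω ΓD : Set (Pt d)} {u : L2 Ω} (c : ℝ)
    (hu : HasZeroTraceOn ΓD u) : HasZeroTraceOn ΓD (c • u) := by
  filter_upwards [hu] with x hx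
  have h := hx.const_mul |c|
  rw [mul_zero] at h
  refine h.congr fun r => ?_
  simp only [setAverage_eq, smul_eq_mul]
  rw [mul_left_comm, ← integral_const_mul]
  congr 1
  refine integral_congr_ae ?_
  filter_upwards [ae_ball_inter x r (Lp.coeFn_smul c u)] with y hy
  simp only [hy, Pi.smul_apply, smul_eq_mul, abs_mul]

/-- `[H¹_D(Ω)]^d`, the fields in `[H¹(Ω)]^d` with vanishing traces on `ΓD`. -/
def H1D (Ω ΓD : Set (Pt d)) : Submodule ℝ (H1 Ω) where
  carrier := {v | ∀ i, HasZeroTraceOn ΓD (comp i v)}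
  add_mem' hv hw i := by rw [map_add]; exact (hv i).add (hw i)
  zero_mem' i := by
    rw [map_zero]
    refine Eventually.of_forall fun x => ?_
    refine tendsto_const_nhds.congr fun r => ?_
    rw [setAverage_eq]
    have : ∫ y in Metric.ball x r ∩ Ω, |(0 : L2 Ω) y| = 0 := by
      rw [← integral_zero (Pt d) ℝ]
      refine integral_congr_ae ?_
      filter_upwards [ae_ball_inter x r (Lp.coeFn_zero ℝ 2 (volume.restrict Ω))] with y hy
      rw [hy, Pi.zero_apply, abs_zero]
    rw [this, smul_zero]
  smul_mem' c v hv i := by rw [map_smul]; exact (hv i).smul c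

/-- `ρ` is (the restriction to `Ω` of) a rigid body motion `x ↦ c + m x`, `m` antisymmetric. -/
def IsRigidMotion {Ω : Set (Pt d)} (ρ : Fin d → L2 Ω) : Prop :=
  ∃ (c : Fin d → ℝ) (m : Matrix (Fin d) (Fin d) ℝ), m.transpose = -m ∧
    ∀ i, ρ i =ᵐ[(volume : Measure (Pt d)).restrict Ω] fun x => c i + ∑ j, m i j * x j

/-- The fields in `[H¹(Ω)]^d` that are `L²`-orthogonal to the rigid body motions. -/
def H1RigidPerp (Ω : Set (Pt d)) : Submodule ℝ (H1 Ω) where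
  carrier := {v | ∀ ρ : Fin d → L2 Ω, IsRigidMotion ρ → ∑ i, inner ℝ (comp i v) (ρ i) = 0}
  add_mem' hv hw ρ hρ := by
    simp only [map_add, inner_add_left, Finset.sum_add_distrib, hv ρ hρ, hw ρ hρ, add_zero]
  zero_mem' ρ _ := by simp
  smul_mem' c v hv ρ hρ := by
    simp only [map_smul, real_inner_smul_left, ← Finset.mul_sum, hv ρ hρ, mul_zero]

/-- The open unit cube `(0,1)^d`. -/
def unitCube (d : ℕ) : Set (Pt d) := {x | ∀ i, x i ∈ Ioo (0 : ℝ) 1}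

/-- Smooth functions on `ℝ^d` that have period one in each coordinate. -/
def IsPeriodicTest (φ : Pt d → ℝ) : Prop :=
  ContDiff ℝ (⊤ : ℕ∞) φ ∧ ∀ (k : Fin d) (x : Pt d), φ (x + EuclideanSpace.single k 1) = φ x

theorem isBounded_unitCube : Bornology.IsBounded (unitCube d) := by
  refine isBounded_iff_forall_norm_le.2 ⟨√(∑ _i : Fin d, 1), fun x hx => ?_⟩
  rw [EuclideanSpace.norm_eq]
  refine Real.sqrt_le_sqrt (Finset.sum_le_sum fun i _ => ?_)
  have := hx i
  rw [Real.norm_eq_abs, sq_abs]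
  nlinarith [this.1, this.2]

theorem memLp_unitCube {f : Pt d → ℝ} (hf : Continuous f) :
    MemLp f 2 ((volume : Measure (Pt d)).restrict (unitCube d)) := by
  have hK : IsCompact (closure (unitCube d)) := isBounded_unitCube.isCompact_closure
  have h : MemLp f 2 ((volume : Measure (Pt d)).restrict (closure (unitCube d))) := by
    have : IsFiniteMeasure ((volume : Measure (Pt d)).restrict (closure (unitCube d))) :=
      ⟨by rw [Measure.restrict_apply_univ]; exact hK.measure_lt_top⟩
    obtain ⟨C, hC⟩ := hK.exists_bound_of_continuousOn hf.continuousOn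
    refine MemLp.of_bound hf.aestronglyMeasurable C ?_
    exact (ae_restrict_iff' isClosed_closure.measurableSet).2 (Eventually.of_forall hC)
  exact h.mono_measure (Measure.restrict_mono subset_closure le_rfl)

/-- The periodic `H¹` fields of mean zero on the unit cube: those whose weak gradient on the cube
is also the weak gradient on the torus, i.e. against smooth periodic functions. -/
def H1Per (d : ℕ) : Submodule ℝ (H1 (unitCube d)) where
  carrier := {v | (∀ i j : Fin d, ∀ φ : Pt d → ℝ, IsPeriodicTest φ →
      ∫ x in unitCube d, comp i v x * pderiv j φ x
        = -∫ x in unitCube d, grad i j v x * φ x) ∧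
    ∀ i : Fin d, ∫ x in unitCube d, comp i v x * 1 = 0}
  add_mem' := by
    intro v w hv hw
    refine ⟨fun i j φ hφ => ?_, fun i => ?_⟩
    · have h1 := hv.1 i j φ hφ
      have h2 := hw.1 i j φ hφ
      rw [map_add, map_add, integral_add_mul_L2 _ _ (memLp_unitCube (continuous_pderiv j hφ.1)),
        integral_add_mul_L2 _ _ (memLp_unitCube hφ.1.continuous), h1, h2]
      ring
    · rw [map_add, integral_add_mul_L2 _ _ (memLp_unitCube continuous_const), hv.2 i, hw.2 i,
        add_zero]
  zero_mem' := by
    refine ⟨fun i j φ _ => ?_, fun i => ?_⟩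
    · rw [map_zero, map_zero, integral_zero_mul_L2, integral_zero_mul_L2, neg_zero]
    · rw [map_zero, integral_zero_mul_L2]
  smul_mem' := by
    intro c v hv
    refine ⟨fun i j φ hφ => ?_, fun i => ?_⟩
    · rw [map_smul, map_smul, integral_smul_mul_L2, integral_smul_mul_L2, hv.1 i j φ hφ]
      ring
    · rw [map_smul, integral_smul_mul_L2, hv.2 i, mul_zero]

/-- The displacement spaces `V ⊆ [H¹(Ω)]^d`: vanishing trace on a closed part `ΓD` of the boundary
of nonzero `(d-1)`-dimensional measure; orthogonality to the rigid body motions (pure traction); or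
periodic boundary conditions on the unit cube. -/
inductive IsDisplacementSpace : (Ω : Set (Pt d)) → Submodule ℝ (H1 Ω) → Prop
  | dirichlet (Ω ΓD : Set (Pt d)) (hclosed : IsClosed ΓD) (hsub : ΓD ⊆ frontier Ω)
      (hpos : (Measure.hausdorffMeasure ((d : ℝ) - 1) : Measure (Pt d)) ΓD ≠ 0) :
      IsDisplacementSpace Ω (H1D Ω ΓD)
  | traction (Ω : Set (Pt d)) : IsDisplacementSpace Ω (H1RigidPerp Ω)
  | periodic : IsDisplacementSpace (unitCube d) (H1Per d)

section Discrete

variable {Ω : Set (Pt d)} (Vh : Submodule ℝ (H1 Ω)) (Qh : Submodule ℝ (L2 Ω))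

/-- The discrete inf-sup condition with constant `β`:
`inf_{q ∈ Qh} sup_{v ∈ Vh} (div v, q) / (‖∇v‖ ‖q‖) ≥ β`. -/
def DiscreteInfSup (β : ℝ) : Prop :=
  ∀ q ∈ Qh, q ≠ 0 → β ≤ ⨆ v : {v : Vh // v ≠ 0}, b v.1.1 q / (gradNorm v.1.1 * ‖q‖)

/-- The discrete operator `A^h_λ : Vh → Vh'`,
`⟨A^h_λ u, v⟩ = a(u, v) + λ b(v, Π_h div u)`, with `Π_h` the `L²`-projection onto `Qh`. -/
def discA [FiniteDimensional ℝ Qh] (lam : ℝ) : Vh →ₗ[ℝ] Module.Dual ℝ Vh :=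
  LinearMap.mk₂ ℝ
    (fun u v : Vh => a u.1 v.1 + lam * b v.1 (Qh.starProjection (divergence u.1)))
    (fun u u' v => by simp only [Submodule.coe_add, map_add, LinearMap.add_apply]; ring)
    (fun c u v => by
      simp only [Submodule.coe_smul, map_smul, LinearMap.smul_apply, smul_eq_mul]; ring)
    (fun u v v' => by simp only [Submodule.coe_add, map_add, LinearMap.add_apply]; ring)
    (fun c u v => by
      simp only [Submodule.coe_smul, map_smul, LinearMap.smul_apply, smul_eq_mul]; ring)

/-- The discretely divergence-free fields `W_h = {v ∈ Vh : b(v, q) = 0 for all q ∈ Qh}`. -/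
def discW : Submodule ℝ Vh where
  carrier := {v | ∀ q ∈ Qh, b v.1 q = 0}
  add_mem' hv hw q hq := by
    simp only [Submodule.coe_add, map_add, LinearMap.add_apply, hv q hq, hw q hq, add_zero]
  zero_mem' q _ := by simp
  smul_mem' c v hv q hq := by
    simp only [Submodule.coe_smul, map_smul, LinearMap.smul_apply, hv q hq, smul_zero]

/-- `P : Vh → W_h` is the orthogonal projection with respect to `a`. -/
def IsDiscProjection (P : Vh →ₗ[ℝ] Vh) : Prop :=
  ∀ v, P v ∈ discW Vh Qh ∧ ∀ w ∈ discW Vh Qh, a (P v).1 w.1 = a v.1 w.1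

open Classical in
/-- The `a`-orthogonal projection `P_h : Vh → W_h` (zero if there is none). -/
def discP : Vh →ₗ[ℝ] Vh :=
  if h : ∃ P : Vh →ₗ[ℝ] Vh, IsDiscProjection Vh Qh P then h.choose else 0

variable {Vh} in
open Classical in
/-- The inverse `X⁻¹ : Vh' → Vh` of a bijective operator `X : Vh → Vh'` (otherwise zero). -/
def invOp (X : Vh →ₗ[ℝ] Module.Dual ℝ Vh) : Module.Dual ℝ Vh →ₗ[ℝ] Vh :=
  if h : Function.Bijective X then (LinearEquiv.ofBijective X h).symm else 0

/-- The preconditioner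
`M^h_λ = λ/(1+λ) P_h A_h⁻¹ + 1/(1+λ) A_h⁻¹ : Vh' → Vh`, where `A_h = A^h_0`. -/
def discM [FiniteDimensional ℝ Qh] (lam : ℝ) : Module.Dual ℝ Vh →ₗ[ℝ] Vh :=
  (lam / (1 + lam)) • (discP Vh Qh ∘ₗ invOp (discA Vh Qh 0))
    + (1 / (1 + lam)) • invOp (discA Vh Qh 0)

variable {Vh} in
/-- `X ≂ Y` with constant `C`: `⟨g, X g⟩ ≤ C ⟨g, Y g⟩` and `⟨g, Y g⟩ ≤ C ⟨g, X g⟩`. -/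
def SpectrallyEquivalent (C : ℝ) (X Y : Module.Dual ℝ Vh →ₗ[ℝ] Vh) : Prop :=
  (∀ g : Module.Dual ℝ Vh, g (X g) ≤ C * g (Y g)) ∧
    ∀ g : Module.Dual ℝ Vh, g (Y g) ≤ C * g (X g)

/-- `(v₀, p) ∈ Vh × Qh` solves the discrete Stokes problem with data `v`. -/
def IsDiscStokesSolution (v v₀ : Vh) (p : Qh) : Prop :=
  (∀ w : Vh, a v₀.1 w.1 + b w.1 p.1 = a v.1 w.1) ∧ ∀ q : Qh, b v₀.1 q.1 = 0

end Discrete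

end Elasticity

end

namespace Elasticity

/-! ### Positive forms on an abstract space: projection, inf-sup, energy comparison. -/

section PositiveForms

variable {H : Type*} [AddCommGroup H] [Module ℝ H]

/-! Write `B` for the discrete divergence `Π_h div`, so that `A^h_λ = A + λ B*B` and `W_h = ker B`.
For `g` in the dual put `f = A⁻¹g`, `u = (A^h_λ)⁻¹g` and `p = P_h f`. Both `u` and `f` have
`a`-projection `p` onto `ker B`, and their remainders `z = u - p`, `e = f - p` are `a`-orthogonal to
`ker B`. Hence the two quadratic forms are `a(p,p) + ⟨A^h_λ z, z⟩` and `a(p,p) + a(e,e)/(1+λ)`, with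
`A^h_λ z = A e` as functionals.

On the complement of `ker B` one has `β² a(z,z) ≤ ‖Bz‖²` by inf-sup, and everywhere `‖Bv‖² ≤ d
a(v,v)`. There `A^h_λ` therefore lies between `(1+λβ²)A` and `(1+λd)A`, and both factors are
comparable to `1+λ` uniformly in `λ`. This is `energy_equiv`, with the lower bound from
`form_le_norm_sq_of_infSup`.

Korn's inequality is not needed: `‖ε(v)‖ ≤ ‖∇v‖` turns the assumed inf-sup condition into one for
the energy norm with the same `β`. Only definiteness of `a` on `V` is required, since `V_h` is
finite-dimensional. It is `IsDisplacementSpace.eq_zero_of_strain_eq_zero`: vanishing strain forces a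
rigid motion, and each type of space excludes the nonzero ones. -/

theorem dual_apply_combination (g : Module.Dual ℝ H) (s t : ℝ) (x y : H) :
    g (s • x + t • y) = s * g x + t * g y := by
  simp

theorem bijective_of_posDef [FiniteDimensional ℝ H]
    {A : H →ₗ[ℝ] Module.Dual ℝ H} (hA : ∀ v, v ≠ 0 → 0 < A v v) :
    Function.Bijective A := by
  have hinj : Function.Injective A := by
    rw [injective_iff_map_eq_zero]
    intro v hv
    by_contra hne
    have := hA v hne
    rw [hv, LinearMap.zero_apply] at this
    exact lt_irrefl _ this
  exact ⟨hinj, (LinearMap.injective_iff_surjective_of_finrank_eq_finrank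
    (Subspace.dual_finrank_eq).symm).1 hinj⟩

/-- The orthogonal projection onto `W` with respect to a positive definite form. -/
theorem exists_orthogonal_projection [FiniteDimensional ℝ H]
    {A : H →ₗ[ℝ] H →ₗ[ℝ] ℝ} (hA : ∀ v, v ≠ 0 → 0 < A v v) (W : Submodule ℝ H) :
    ∃ P : H →ₗ[ℝ] H, ∀ v, P v ∈ W ∧ ∀ w ∈ W, A (P v) w = A v w := by
  -- Restricted to `W` the form is still positive definite, so `A v` restricted to `W` has a unique
  -- representer in `W`; this is `P v`.
  have hbij : Function.Bijective (A.compl₁₂ W.subtype W.subtype : W →ₗ[ℝ] W →ₗ[ℝ] ℝ) :=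
    bijective_of_posDef fun w hw => hA w fun h => hw (Subtype.ext h)
  let e := LinearEquiv.ofBijective _ hbij
  refine ⟨W.subtype ∘ₗ e.symm.toLinearMap ∘ₗ A.compl₁₂ LinearMap.id W.subtype,
    fun v => ⟨Subtype.coe_prop _, fun w hw => ?_⟩⟩
  exact DFunLike.congr_fun (e.apply_symm_apply (A.compl₁₂ LinearMap.id W.subtype v)) ⟨w, hw⟩

theorem eq_of_forall_form_eq {A : H →ₗ[ℝ] H →ₗ[ℝ] ℝ} (hA : ∀ v, v ≠ 0 → 0 < A v v)
    {W : Submodule ℝ H} {x y : H} (hx : x ∈ W) (hy : y ∈ W) (h : ∀ w ∈ W, A x w = A y w) :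
    x = y := by
  by_contra hne
  have h1 := hA _ (sub_ne_zero.2 hne)
  rw [LinearMap.map_sub A, LinearMap.sub_apply, h _ (W.sub_mem hx hy), sub_self] at h1
  exact lt_irrefl _ h1

theorem form_sq_le {A : H →ₗ[ℝ] H →ₗ[ℝ] ℝ} (hA : ∀ v, 0 ≤ A v v) (hs : ∀ u v, A u v = A v u)
    (u v : H) : A u v ^ 2 ≤ A u u * A v v := by
  have := LinearMap.BilinForm.apply_mul_apply_le_of_forall_zero_le A hA u v
  rwa [hs v u, ← sq] at this

variable {Q : Type*} [NormedAddCommGroup Q] [InnerProductSpace ℝ Q]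

/-- A functional that vanishes on the kernel of `B` is of the form `v ↦ (q, B v)`. -/
theorem exists_inner_eq_of_vanish_on_ker [FiniteDimensional ℝ Q] (B : H →ₗ[ℝ] Q) (f : Module.Dual ℝ H)
    (hf : ∀ v, B v = 0 → f v = 0) : ∃ q : Q, ∀ v, f v = inner ℝ q (B v) := by
  have h1 : f ∈ (LinearMap.ker B).dualAnnihilator := by
    rw [Submodule.mem_dualAnnihilator]
    exact fun v hv => hf v (LinearMap.mem_ker.1 hv)
  rw [← LinearMap.range_dualMap_eq_dualAnnihilator_ker] at h1
  obtain ⟨ψ, rfl⟩ := h1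
  have : CompleteSpace Q := FiniteDimensional.complete ℝ Q
  refine ⟨(InnerProductSpace.toDual ℝ Q).symm (LinearMap.toContinuousLinearMap ψ), fun v => ?_⟩
  rw [InnerProductSpace.toDual_symm_apply]
  rfl

/-- The inf-sup bound for `B` gives a lower bound for `B` on the orthogonal complement of its
kernel. -/
theorem form_le_norm_sq_of_infSup [FiniteDimensional ℝ Q]
    {A : H →ₗ[ℝ] H →ₗ[ℝ] ℝ} (hA : ∀ v, 0 ≤ A v v)
    (hs : ∀ u v, A u v = A v u) (B : H →ₗ[ℝ] Q) {β : ℝ} (hβ : 0 < β)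
    (hB : ∀ (q : Q) (S : ℝ), 0 ≤ S → (∀ v, inner ℝ q (B v) ≤ S * √(A v v)) → β * ‖q‖ ≤ S)
    {z : H} (hz : ∀ v, B v = 0 → A z v = 0) : β ^ 2 * A z z ≤ ‖B z‖ ^ 2 := by
  -- Duality: with `A z = (q, B ·)`, inf-sup bounds `‖q‖` by the energy norm of `z`, and evaluating
  -- at `z` gives `A z z ≤ ‖q‖ ‖B z‖`.
  obtain ⟨q, hq⟩ := exists_inner_eq_of_vanish_on_ker B (A z) hz
  have h1 : β * ‖q‖ ≤ √(A z z) := by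
    refine hB q _ (Real.sqrt_nonneg _) fun v => ?_
    rw [← hq, ← Real.sqrt_mul (hA z)]
    exact Real.le_sqrt_of_sq_le (form_sq_le hA hs z v)
  have h2 : A z z ≤ ‖q‖ * ‖B z‖ := by rw [hq]; exact real_inner_le_norm _ _
  have h3 := Real.sq_sqrt (hA z)
  rcases eq_or_lt_of_le (Real.sqrt_nonneg (A z z)) with h0 | h0
  · rw [← h3, ← h0]; nlinarith [sq_nonneg ‖B z‖]
  · have h4 : β * √(A z z) ≤ ‖B z‖ := by
      refine le_of_mul_le_mul_right ?_ h0
      nlinarith [norm_nonneg (B z), mul_le_mul_of_nonneg_left h2 hβ.le,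
        mul_le_mul_of_nonneg_right h1 (norm_nonneg (B z))]
    calc β ^ 2 * A z z = (β * √(A z z)) ^ 2 := by rw [mul_pow, h3]
      _ ≤ ‖B z‖ ^ 2 := pow_le_pow_left₀ (by positivity) h4 2

/-- If `u` solves the problem for `A + λ B*B` with the right-hand side `A(f, ·)`, then the energy
of `u` is equivalent to that of the preconditioned solution. -/
theorem energy_equiv {A : H →ₗ[ℝ] H →ₗ[ℝ] ℝ} (hA : ∀ v, 0 ≤ A v v)
    (hs : ∀ u v, A u v = A v u) (B : H →ₗ[ℝ] Q) {β D lam : ℝ} (hβ : 0 < β) (hD : 0 < D)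
    (hl : 0 ≤ lam) (hup : ∀ v, ‖B v‖ ^ 2 ≤ D * A v v)
    (hlow : ∀ z, (∀ v, B v = 0 → A z v = 0) → β ^ 2 * A z z ≤ ‖B z‖ ^ 2)
    {f p u : H} (hp : B p = 0) (hfp : ∀ v, B v = 0 → A p v = A f v)
    (hu : ∀ v, A u v + lam * inner ℝ (B u) (B v) = A f v) {C : ℝ} (hC1 : 1 ≤ C) (hCD : D ≤ C)
    (hCβ : 1 ≤ C * β ^ 2) :
    A f u ≤ C * (lam / (1 + lam) * A f p + 1 / (1 + lam) * A f f) ∧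
      lam / (1 + lam) * A f p + 1 / (1 + lam) * A f f ≤ C * A f u := by
  set z := u - p with hz
  set e := f - p with he
  have hl1 : 0 < 1 + lam := by linarith
  have hBz : B z = B u := by rw [hz, map_sub, hp, sub_zero]
  have hzW : ∀ v, B v = 0 → A z v = 0 := by
    intro v hv
    have := hu v
    rw [hv, inner_zero_right, mul_zero, add_zero] at this
    rw [hz, map_sub, LinearMap.sub_apply, this, hfp v hv, sub_self]
  have heW : ∀ v, B v = 0 → A e v = 0 := by
    intro v hv
    rw [he, map_sub, LinearMap.sub_apply, hfp v hv, sub_self]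
  have hf : f = p + e := by rw [he]; abel
  have hu' : u = p + z := by rw [hz]; abel
  -- The form of `A + λ B*B`. Since `B p = 0`, subtracting `A p` from the equation for `u` leaves
  -- `Al z = A e`.
  let Al : H →ₗ[ℝ] H →ₗ[ℝ] ℝ := A + lam • (innerₗ Q).compl₁₂ B B
  have hAl : ∀ x y, Al x y = A x y + lam * inner ℝ (B x) (B y) := fun x y => by
    simp [Al]
  have hAl0 : ∀ x, Al x x = A x x + lam * ‖B x‖ ^ 2 := fun x => by
    rw [hAl, real_inner_self_eq_norm_sq]
  have hAlnn : ∀ x, 0 ≤ Al x x := fun x => by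
    rw [hAl0]; have := hA x; positivity
  have hAls : ∀ x y, Al x y = Al y x := fun x y => by
    rw [hAl, hAl, hs, real_inner_comm]
  have hze : ∀ v, Al z v = A e v := by
    intro v
    rw [hAl, hBz, hz, he, map_sub, map_sub, LinearMap.sub_apply, LinearMap.sub_apply, ← hu v]
    ring
  have hpe : A p e = 0 := by rw [hs]; exact heW p hp
  have hep : A e p = 0 := heW p hp
  have hpz : A p z = 0 := by rw [hs]; exact hzW p hp
  have hfu : A f u = A p p + Al z z := by
    rw [hze, hf, hu']
    simp only [map_add, LinearMap.add_apply, hpz, hep]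
    ring
  have hfp' : A f p = A p p := by
    rw [hf]; simp only [map_add, LinearMap.add_apply, hep, add_zero]
  have hff : A f f = A p p + A e e := by
    rw [hf]; simp only [map_add, LinearMap.add_apply, hep, hpe]; ring
  have hM : lam / (1 + lam) * A f p + 1 / (1 + lam) * A f f = A p p + A e e / (1 + lam) := by
    rw [hfp', hff]; field_simp; ring
  have hzz := hAlnn z
  have hee := hA e
  have hpp := hA p
  -- Cauchy–Schwarz for `A` applied to `A e z = Al z z`, with the inf-sup lower bound for `‖B z‖`.
  have key1 : (1 + lam * β ^ 2) * Al z z ≤ A e e := by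
    have h1 := form_sq_le hA hs e z
    rw [← hze] at h1
    have h2 : (1 + lam * β ^ 2) * A z z ≤ Al z z := by
      rw [hAl0]; nlinarith [mul_le_mul_of_nonneg_left (hlow z hzW) hl]
    have h3 : 0 < 1 + lam * β ^ 2 := by positivity
    rcases eq_or_lt_of_le hzz with h0 | h0
    · rw [← h0, mul_zero]; exact hee
    · refine le_of_mul_le_mul_right ?_ h0
      nlinarith [mul_le_mul_of_nonneg_left h2 hee, mul_le_mul_of_nonneg_left h1 h3.le]
  -- The mirror argument: Cauchy–Schwarz for `Al` applied to `Al z e = A e e`, with the upper bound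
  -- for `‖B e‖`.
  have key2 : A e e ≤ (1 + lam * D) * Al z z := by
    have h1 := form_sq_le hAlnn hAls z e
    rw [hze] at h1
    have h2 : Al e e ≤ (1 + lam * D) * A e e := by
      rw [hAl0]; nlinarith [mul_le_mul_of_nonneg_left (hup e) hl]
    have h3 : 0 < 1 + lam * D := by positivity
    rcases eq_or_lt_of_le hee with h0 | h0
    · rw [← h0]; positivity
    · refine le_of_mul_le_mul_right ?_ h0
      nlinarith [mul_le_mul_of_nonneg_left h2 hzz]
  have h1 : Al z z ≤ C * (A e e / (1 + lam)) := by
    rw [← mul_div_assoc, le_div_iff₀ hl1, mul_comm]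
    have h2 : 1 + lam ≤ C * (1 + lam * β ^ 2) := by
      nlinarith [mul_le_mul_of_nonneg_left hCβ hl]
    calc (1 + lam) * Al z z ≤ C * (1 + lam * β ^ 2) * Al z z :=
          mul_le_mul_of_nonneg_right h2 hzz
      _ ≤ C * A e e := by
          rw [mul_assoc]; exact mul_le_mul_of_nonneg_left key1 (by linarith)
  have h2 : A e e / (1 + lam) ≤ C * Al z z := by
    rw [div_le_iff₀ hl1]
    have h3 : 1 + lam * D ≤ C * (1 + lam) := by
      nlinarith [mul_le_mul_of_nonneg_left hCD hl]
    calc A e e ≤ (1 + lam * D) * Al z z := key2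
      _ ≤ C * (1 + lam) * Al z z := mul_le_mul_of_nonneg_right h3 hzz
      _ = C * Al z z * (1 + lam) := by ring
  have h3 : A p p ≤ C * A p p := le_mul_of_one_le_left hpp hC1
  rw [hM, hfu, mul_add, mul_add]
  exact ⟨add_le_add h3 h1, add_le_add h3 h2⟩

end PositiveForms

variable {d : ℕ}

/-! ### Functions with vanishing weak gradient are constant. -/

section WeakGradient

theorem IsTestFunction.pderiv {Ω : Set (Pt d)} {φ : Pt d → ℝ} (j : Fin d)
    (hφ : IsTestFunction Ω φ) : IsTestFunction Ω (pderiv j φ) :=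
  ⟨(hφ.1.fderiv_right (m := (⊤ : ℕ∞)) (by simp)).clm_apply contDiff_const,
    hφ.2.1.fderiv_apply (𝕜 := ℝ) (EuclideanSpace.single j 1),
    (tsupport_fderiv_apply_subset ℝ (EuclideanSpace.single j 1)).trans hφ.2.2⟩

theorem pderiv_comm {φ : Pt d → ℝ} (hφ : ContDiff ℝ (⊤ : ℕ∞) φ) (j k : Fin d) (x : Pt d) :
    pderiv j (pderiv k φ) x = pderiv k (pderiv j φ) x := by
  have hd : DifferentiableAt ℝ (fderiv ℝ φ) x :=
    ((hφ.fderiv_right (m := 1) (by norm_cast)).differentiable (by simp)) x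
  have h : ∀ i l : Fin d, pderiv i (pderiv l φ) x
      = fderiv ℝ (fderiv ℝ φ) x (EuclideanSpace.single i 1) (EuclideanSpace.single l 1) := by
    intro i l
    unfold pderiv
    rw [fderiv_clm_apply hd (differentiableAt_const _)]
    simp
  rw [h, h]
  exact (hφ.contDiffAt.isSymmSndFDerivAt (by simp; norm_cast)) _ _

theorem clm_eq_zero_of_single {f : Pt d →L[ℝ] ℝ}
    (h : ∀ j, f (EuclideanSpace.single j 1) = 0) : f = 0 := by
  have : (f : Pt d →ₗ[ℝ] ℝ) = 0 :=
    (EuclideanSpace.basisFun (Fin d) ℝ).toBasis.ext fun j => by simpa using h j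
  ext x
  exact DFunLike.congr_fun this x

open scoped Convolution in
/-- A function with zero weak gradient is constant near each point. -/
theorem exists_ae_eq_const_on_ball {u : Pt d → ℝ} (hu : LocallyIntegrable u) {x : Pt d} {r : ℝ}
    (hr : 0 < r) (h : ∀ (j : Fin d) (φ : Pt d → ℝ), IsTestFunction (Metric.ball x (2 * r)) φ →
      ∫ y, u y * pderiv j φ y = 0) :
    ∃ c, ∀ᵐ y, y ∈ Metric.ball x r → u y = c := by
  -- Mollifiers of radius at most `r`: centred at a point of `ball x r` they are admissible test
  -- functions in `ball x (2 * r)`. The ratio `rOut = 2 * rIn` stays bounded, as almost-everywhere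
  -- convergence of the mollifications requires.
  let ρ : ℕ → ContDiffBump (0 : Pt d) := fun n =>
    { rIn := r / (2 * (n + 1))
      rOut := r / (n + 1)
      rIn_pos := by positivity
      rIn_lt_rOut := div_lt_div_of_pos_left hr (by positivity) (by linarith) }
  have hlim : Tendsto (fun n => (ρ n).rOut) atTop (𝓝 0) := by
    simpa [ρ, div_eq_mul_inv] using
      (tendsto_one_div_add_atTop_nhds_zero_nat (𝕜 := ℝ)).const_mul r
  have hle : ∀ n, (ρ n).rOut ≤ r := fun n => div_le_self hr.le (by
    have : (0 : ℝ) ≤ n := n.cast_nonneg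
    linarith)
  have hconst : ∀ n, ∀ y ∈ Metric.ball x r, ∀ z ∈ Metric.ball x r,
      ((ρ n).normed volume ⋆[ContinuousLinearMap.lsmul ℝ ℝ, volume] u) y
        = ((ρ n).normed volume ⋆[ContinuousLinearMap.lsmul ℝ ℝ, volume] u) z := by
    intro n
    set g : Pt d → ℝ := (ρ n).normed volume with hg
    have hgc : HasCompactSupport g := (ρ n).hasCompactSupport_normed
    have hgd : ContDiff ℝ (⊤ : ℕ∞) g := (ρ n).contDiff_normed
    have hgd1 : ContDiff ℝ 1 g := (ρ n).contDiff_normed (n := 1)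
    -- With the mollifier as right factor, the derivative of the convolution falls on it, and
    -- becomes the integral of `u` against the derivative of a test function.
    rw [← convolution_flip]
    set L := (ContinuousLinearMap.lsmul ℝ ℝ : ℝ →L[ℝ] ℝ →L[ℝ] ℝ).flip
    have hder := hgc.hasFDerivAt_convolution_right (μ := volume) L hu hgd1
    have hzero : ∀ y ∈ Metric.ball x r,
        (u ⋆[L.precompR (Pt d), volume] fderiv ℝ g) y = 0 := by
      intro y hy
      refine clm_eq_zero_of_single fun j => ?_
      rw [convolution_precompR_apply L hu (hgc.fderiv ℝ) (hgd1.continuous_fderiv (by simp)),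
        convolution_def]
      have htest : IsTestFunction (Metric.ball x (2 * r)) fun t => g (y - t) := by
        have hsupp : tsupport (fun t => g (y - t)) ⊆ Metric.closedBall y (ρ n).rOut := by
          refine closure_minimal (fun t ht => ?_) Metric.isClosed_closedBall
          have h1 : y - t ∈ Function.support g := ht
          rw [hg, (ρ n).support_normed_eq, mem_ball_zero_iff] at h1
          rw [Metric.mem_closedBall, dist_comm, dist_eq_norm]
          exact h1.le
        refine ⟨hgd.comp (contDiff_const.sub contDiff_id), ?_, hsupp.trans fun t ht => ?_⟩
        · exact HasCompactSupport.of_support_subset_isCompact (isCompact_closedBall y (ρ n).rOut)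
            ((subset_tsupport _).trans hsupp)
        · rw [Metric.mem_ball] at hy ⊢
          rw [Metric.mem_closedBall] at ht
          linarith [dist_triangle t y x, hle n]
      have h1 := h j _ htest
      have h2 : ∀ t, pderiv j (fun t => g (y - t)) t
          = -(fderiv ℝ g (y - t) (EuclideanSpace.single j 1)) := by
        intro t
        have h3 := ((hgd1.differentiable (by simp)) (y - t)).hasFDerivAt.comp t
          ((hasFDerivAt_id t).const_sub y)
        unfold pderiv
        rw [show (fun t => g (y - t)) = g ∘ HSub.hSub y from rfl, h3.fderiv]
        simp
      simp only [h2, mul_neg, integral_neg, neg_eq_zero] at h1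
      rw [← h1]
      refine integral_congr_ae (Eventually.of_forall fun t => ?_)
      simp [L, mul_comm]
    intro y hy z hz
    refine Metric.isOpen_ball.is_const_of_fderiv_eq_zero (𝕜 := ℝ)
      (convex_ball x r).isPreconnected (fun w _ => (hder w).differentiableAt.differentiableWithinAt)
      (fun w hw => ?_) hy hz
    rw [(hder w).fderiv, hzero w hw]
    rfl
  have hae := ContDiffBump.ae_convolution_tendsto_right_of_locallyIntegrable (K := 2) (φ := ρ)
    hlim (Eventually.of_forall fun n => by
      simp only [ρ]
      rw [← mul_div_assoc, mul_div_mul_left _ _ (by norm_num : (2 : ℝ) ≠ 0)]) hu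
  -- The constant is the value of `u` at any point of convergence in the ball. If there is none, the
  -- ball is null by `hae` and any constant serves.
  by_cases hex : ∃ z ∈ Metric.ball x r, Tendsto (fun n => ((ρ n).normed volume
      ⋆[ContinuousLinearMap.lsmul ℝ ℝ, volume] u) z) atTop (𝓝 (u z))
  · obtain ⟨z, hz, hzt⟩ := hex
    refine ⟨u z, ?_⟩
    filter_upwards [hae] with y hy hyb
    exact tendsto_nhds_unique (hy.congr fun n => hconst n y hyb z hz) hzt
  · refine ⟨0, ?_⟩
    filter_upwards [hae] with y hy hyb
    exact absurd ⟨y, hyb, hy⟩ hex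

/-- A function with zero weak gradient on a connected open set is constant. -/
theorem exists_ae_eq_const_of_weak_grad_eq_zero {Ω : Set (Pt d)} (ho : IsOpen Ω)
    (hc : IsPreconnected Ω) {u : Pt d → ℝ} (hu : IntegrableOn u Ω)
    (h : ∀ (j : Fin d) (φ : Pt d → ℝ), IsTestFunction Ω φ →
      ∫ y in Ω, u y * pderiv j φ y = 0) :
    ∃ c, ∀ᵐ y ∂(volume.restrict Ω), u y = c := by
  have hui : Integrable (Ω.indicator u) := (integrable_indicator_iff ho.measurableSet).2 hu
  have hloc : ∀ x ∈ Ω, ∃ c, ∃ r > 0, Metric.ball x r ⊆ Ω ∧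
      ∀ᵐ y, y ∈ Metric.ball x r → u y = c := by
    intro x hx
    obtain ⟨R, hR, hRΩ⟩ := Metric.isOpen_iff.1 ho x hx
    have hsub : Metric.ball x (R / 2) ⊆ Ω :=
      (Metric.ball_subset_ball (by linarith)).trans hRΩ
    obtain ⟨c, hc⟩ := exists_ae_eq_const_on_ball hui.locallyIntegrable (half_pos hR) (x := x)
      (fun j φ hφ => by
        rw [← h j φ ⟨hφ.1, hφ.2.1, hφ.2.2.trans (by rwa [mul_div_cancel₀ _ two_ne_zero])⟩,
          ← integral_indicator ho.measurableSet]
        congr 1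
        ext y
        by_cases hy : y ∈ Ω <;> simp [hy])
    refine ⟨c, R / 2, half_pos hR, hsub, ?_⟩
    filter_upwards [hc] with y hy hyb
    rw [← hy hyb, indicator_of_mem (hsub hyb)]
  choose! f R hR hsub hf using hloc
  have hconst : ∀ x ∈ Ω, ∀ y ∈ Ω, f x = f y := by
    intro x hx y hy
    -- The local constants agree for nearby centres, because the two balls overlap in a nonempty
    -- open set, which has positive measure; preconnectedness does the rest.
    refine hc.induction₂ (fun x y => f x = f y) (fun x hx => ?_)
      (fun x y z _ _ _ h1 h2 => h1.trans h2) (fun x y _ _ h => h.symm) hx hy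
    filter_upwards [mem_nhdsWithin_of_mem_nhds (Metric.ball_mem_nhds x (hR x hx)),
      self_mem_nhdsWithin] with y hyb hy
    have hopen : IsOpen (Metric.ball x (R x) ∩ Metric.ball y (R y)) :=
      Metric.isOpen_ball.inter Metric.isOpen_ball
    have hne : (Metric.ball x (R x) ∩ Metric.ball y (R y)).Nonempty :=
      ⟨y, hyb, Metric.mem_ball_self (hR y hy)⟩
    by_contra hfne
    refine (hopen.measure_pos volume hne).ne' ?_
    refine measure_mono_null (fun z hz => ?_) ((hf x hx).and (hf y hy))
    simp only [mem_compl_iff, mem_ofPred_eq, not_and, Classical.not_imp]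
    exact fun h1 => ⟨hz.2, fun h2 => hfne ((h1 hz.1).symm.trans h2)⟩
  rcases Ω.eq_empty_or_nonempty with rfl | ⟨x₀, hx₀⟩
  · exact ⟨0, by simp⟩
  refine ⟨f x₀, (ae_restrict_iff' ho.measurableSet).2 ?_⟩
  refine measure_null_of_locally_null _ fun x hx => ?_
  have hxΩ : x ∈ Ω := by
    by_contra hxn
    exact hx fun h => absurd h hxn
  refine ⟨_, inter_mem_nhdsWithin _ (Metric.ball_mem_nhds x (hR x hxΩ)),
    measure_mono_null (fun z hz => ?_) (hf x hxΩ)⟩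
  intro h1
  exact hz.1 fun _ => (h1 hz.2).trans (hconst x hxΩ x₀ hx₀)

end WeakGradient

/-! ### Fields with vanishing strain are rigid motions. -/

section Rigidity

variable {Ω : Set (Pt d)}

theorem integrableOn_L2 (hb : Bornology.IsBounded Ω) (u : L2 Ω) : IntegrableOn u Ω := by
  have : IsFiniteMeasure ((volume : Measure (Pt d)).restrict Ω) :=
    ⟨by rw [Measure.restrict_apply_univ]; exact hb.measure_lt_top⟩
  exact (Lp.memLp u).integrable (by norm_num)

theorem setIntegral_test {φ : Pt d → ℝ} (hφ : tsupport φ ⊆ Ω) (f : Pt d → ℝ) :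
    ∫ x in Ω, f x * φ x = ∫ x, f x * φ x :=
  setIntegral_eq_integral_of_forall_compl_eq_zero fun x hx => by
    rw [image_eq_zero_of_notMem_tsupport fun h => hx (hφ h), mul_zero]

/-- Elements of `H1` are pairs of a field and its weak gradient, so the gradient component must be
shown to vanish too; this is the fundamental lemma of the calculus of variations. -/
theorem eq_zero_of_comp_eq_zero (ho : IsOpen Ω) (hb : Bornology.IsBounded Ω) {v : H1 Ω}
    (h : ∀ i, comp i v = 0) : v = 0 := by
  refine Subtype.ext (Prod.ext (funext h) (funext₂ fun i j => ?_))
  change grad i j v = 0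
  refine (Lp.eq_zero_iff_ae_eq_zero).2 ((ae_restrict_iff' ho.measurableSet).2 ?_)
  refine ho.ae_eq_zero_of_integral_contDiff_smul_eq_zero
    (integrableOn_L2 hb (grad i j v)).locallyIntegrableOn fun φ h1 h2 h3 => ?_
  have h4 : ∫ x in Ω, comp i v x * pderiv j φ x = -∫ x in Ω, grad i j v x * φ x :=
    v.2 i j φ ⟨h1, h2, h3⟩
  rw [h i, integral_zero_mul_L2, zero_eq_neg, setIntegral_test h3] at h4
  simpa only [smul_eq_mul, mul_comm] using h4

theorem strain_eq_zero_of_a_self {v : H1 Ω} (h : a v v = 0) (i j : Fin d) :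
    strain i j v = 0 := by
  have h1 : ∑ i : Fin d, ∑ j : Fin d, ‖strain i j v‖ ^ 2 = 0 := by
    rw [← h]
    simp [a, LinearMap.sum_apply]
  have h2 := (Finset.sum_eq_zero_iff_of_nonneg fun i _ =>
    Finset.sum_nonneg fun j _ => sq_nonneg ‖strain i j v‖).1 h1 i (Finset.mem_univ i)
  have h3 := (Finset.sum_eq_zero_iff_of_nonneg fun j _ => sq_nonneg ‖strain i j v‖).1 h2 j
    (Finset.mem_univ j)
  simpa using h3

theorem grad_eq_neg_of_strain_eq_zero {v : H1 Ω} (h : ∀ i j, strain i j v = 0) (i j : Fin d) :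
    grad i j v = -grad j i v := by
  have := h i j
  simp only [strain, LinearMap.smul_apply, LinearMap.add_apply] at this
  exact eq_neg_of_add_eq_zero_left ((smul_eq_zero.1 this).resolve_left (by norm_num))

/-- The gradient of a field with vanishing strain has a vanishing weak gradient. -/
theorem integral_grad_mul_pderiv_eq_zero {v : H1 Ω} (h : ∀ i j, strain i j v = 0)
    {φ : Pt d → ℝ} (hφ : IsTestFunction Ω φ) (i j k : Fin d) :
    ∫ x in Ω, grad i j v x * pderiv k φ x = 0 := by
  let T : Fin d → Fin d → Fin d → ℝ := fun i j k => ∫ x in Ω, grad i j v x * pderiv k φ x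
  have hsymm : ∀ i j k, T i j k = T i k j := by
    intro i j k
    have h1 : ∫ x in Ω, comp i v x * pderiv j (pderiv k φ) x = -T i j k :=
      v.2 i j _ (hφ.pderiv k)
    have h2 : ∫ x in Ω, comp i v x * pderiv k (pderiv j φ) x = -T i k j :=
      v.2 i k _ (hφ.pderiv j)
    simp only [pderiv_comm hφ.1 j k] at h1
    linarith
  have hanti : ∀ i j k, T i j k = -T j i k := by
    intro i j k
    have h1 := integral_smul_mul_L2 (-1) (grad j i v) (pderiv k φ)
    rw [neg_one_smul, ← grad_eq_neg_of_strain_eq_zero h i j, neg_one_mul] at h1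
    exact h1
  change T i j k = 0
  -- A three-index array symmetric in the last two indices and antisymmetric in the first two is
  -- zero: alternating the two swaps six times returns to `T i j k` with the opposite sign.
  linarith [hsymm i j k, hanti i k j, hsymm k i j, hanti k j i, hsymm j k i, hanti j i k]

/-- A field with vanishing strain on a bounded domain is a rigid body motion. -/
theorem exists_rigid_of_strain_eq_zero (ho : IsOpen Ω) (hc : IsConnected Ω)
    (hb : Bornology.IsBounded Ω) {v : H1 Ω} (h : ∀ i j, strain i j v = 0) :
    ∃ (c : Fin d → ℝ) (m : Matrix (Fin d) (Fin d) ℝ), m.transpose = -m ∧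
      (∀ i, comp i v =ᵐ[(volume : Measure (Pt d)).restrict Ω] fun x => c i + ∑ j, m i j * x j) ∧
      ∀ i j, grad i j v =ᵐ[(volume : Measure (Pt d)).restrict Ω] fun _ => m i j := by
  have hne : NeZero ((volume : Measure (Pt d)).restrict Ω) :=
    ⟨fun h0 => (ho.measure_pos volume hc.nonempty).ne' (Measure.restrict_eq_zero.1 h0)⟩
  have hG : ∀ i j, ∃ c, ∀ᵐ x ∂(volume.restrict Ω), grad i j v x = c := fun i j =>
    exists_ae_eq_const_of_weak_grad_eq_zero ho hc.isPreconnected (integrableOn_L2 hb _)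
      fun k φ hφ => integral_grad_mul_pderiv_eq_zero h hφ i j k
  choose m hm using hG
  -- The linear field with the constant gradient `m`; subtracting it leaves components with zero
  -- weak gradient.
  let ℓ : Fin d → Pt d →L[ℝ] ℝ := fun i => ∑ j, m i j • EuclideanSpace.proj j
  have hℓ : ∀ i x, ℓ i x = ∑ j, m i j * x j := fun i x => by
    simp [ℓ, sum_apply]
  have hℓ1 : ∀ i j, ℓ i (EuclideanSpace.single j 1) = m i j := fun i j => by
    rw [hℓ]; simp
  have hu : ∀ i, ∃ c, ∀ᵐ x ∂(volume.restrict Ω), comp i v x - ℓ i x = c := by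
    intro i
    have hint : IntegrableOn (ℓ i) Ω :=
      ((ℓ i).continuous.continuousOn.integrableOn_compact hb.isCompact_closure).mono_set
        subset_closure
    refine exists_ae_eq_const_of_weak_grad_eq_zero ho hc.isPreconnected
      ((integrableOn_L2 hb _).sub hint) fun k φ hφ => ?_
    have hcφ := hφ.1.continuous
    have hcp := (hφ.pderiv k).1.continuous
    have i1 : Integrable fun x => ℓ i x * pderiv k φ x :=
      ((ℓ i).continuous.mul hcp).integrable_of_hasCompactSupport (hφ.pderiv k).2.1.mul_left
    have h1 : ∫ x in Ω, comp i v x * pderiv k φ x = -∫ x in Ω, grad i k v x * φ x :=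
      v.2 i k φ hφ
    have h2 : ∫ x in Ω, grad i k v x * φ x = ∫ x in Ω, m i k * φ x := by
      refine integral_congr_ae ?_
      filter_upwards [hm i k] with x hx
      rw [hx]
    have h3 : ∫ x, ℓ i x * pderiv k φ x = -∫ x, m i k * φ x := by
      change ∫ x, ℓ i x * fderiv ℝ φ x (EuclideanSpace.single k 1) = _
      have := integral_mul_fderiv_eq_neg_fderiv_mul_of_integrable (μ := volume) (f := ℓ i) (g := φ)
        (v := EuclideanSpace.single k 1) ?_ i1 ?_
        (fun x _ => (ℓ i).differentiableAt) (fun x _ => (hφ.1.differentiable (by simp)) x)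
      · simpa only [ContinuousLinearMap.fderiv, hℓ1] using this
      · simp only [ContinuousLinearMap.fderiv, hℓ1]
        exact (hcφ.integrable_of_hasCompactSupport hφ.2.1).const_mul _
      · exact ((ℓ i).continuous.mul hcφ).integrable_of_hasCompactSupport hφ.2.1.mul_left
    simp only [sub_mul]
    rw [integral_sub (integrable_mul_L2 _ (memLp_pderiv_testFunction k hφ)) i1.integrableOn, h1, h2,
      setIntegral_test (hφ.pderiv k).2.2, h3, setIntegral_test hφ.2.2]
    ring
  choose c hcu using hu
  refine ⟨c, m, ?_, fun i => ?_, fun i j => hm i j⟩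
  · ext i j
    change m j i = -m i j
    have h1 := Lp.coeFn_neg (grad i j v)
    rw [← grad_eq_neg_of_strain_eq_zero h j i] at h1
    -- Antisymmetry of the constants is read off at a single point, available because `Ω` has
    -- positive measure.
    obtain ⟨x, hx1, hx2, hx3⟩ := (h1.and ((hm i j).and (hm j i))).exists
    rw [← hx2, ← hx3, hx1, Pi.neg_apply]
  · filter_upwards [hcu i] with x hx
    rw [← hx, ← hℓ]
    ring

end Rigidity

/-! ### No nonzero rigid motion lies in a displacement space. -/

section Kernel

variable {Ω : Set (Pt d)}

/-- If `f x ≠ 0`, then `|f| > |f x| / 2` near `x`. Small balls about a point of `closure Ω` meet the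
open set `Ω` in positive measure, so the averages stay at least `|f x| / 2`. -/
theorem eq_zero_of_average_tendsto_zero (ho : IsOpen Ω) {u : L2 Ω} {f : Pt d → ℝ}
    (hf : Continuous f) (hu : u =ᵐ[(volume : Measure (Pt d)).restrict Ω] f) {x : Pt d}
    (hx : x ∈ closure Ω)
    (h : Tendsto (fun r : ℝ => ⨍ y in Metric.ball x r ∩ Ω, |u y|) (𝓝[>] 0) (𝓝 0)) :
    f x = 0 := by
  by_contra hne
  have hε : 0 < |f x| / 2 := half_pos (abs_pos.2 hne)
  have hev : ∀ᶠ y in 𝓝 x, |f x| / 2 < |f y| :=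
    hf.abs.continuousAt.eventually (lt_mem_nhds (half_lt_self (abs_pos.2 hne)))
  obtain ⟨R, hR, hRf⟩ := Metric.eventually_nhds_iff_ball.1 hev
  have hlow : ∀ᶠ r in 𝓝[>] (0 : ℝ), |f x| / 2 ≤ ⨍ y in Metric.ball x r ∩ Ω, |u y| := by
    filter_upwards [Ioo_mem_nhdsGT hR] with r hr
    have hopen : IsOpen (Metric.ball x r ∩ Ω) := Metric.isOpen_ball.inter ho
    have hnon : (Metric.ball x r ∩ Ω).Nonempty :=
      mem_closure_iff_nhds.1 hx _ (Metric.ball_mem_nhds x hr.1)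
    have hfin : volume (Metric.ball x r ∩ Ω) ≠ ⊤ :=
      ((measure_mono inter_subset_left).trans_lt measure_ball_lt_top).ne
    have hpos : 0 < volume.real (Metric.ball x r ∩ Ω) :=
      ENNReal.toReal_pos (hopen.measure_pos volume hnon).ne' hfin
    have h1 : ∫ _y in Metric.ball x r ∩ Ω, |f x| / 2 ≤ ∫ y in Metric.ball x r ∩ Ω, |u y| := by
      refine integral_mono_ae (integrableOn_const hfin) (integrableOn_abs_L2 u x r) ?_
      filter_upwards [ae_ball_inter x r hu, ae_restrict_mem hopen.measurableSet] with y hy hyb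
      rw [hy]
      exact (hRf y (Metric.ball_subset_ball hr.2.le hyb.1)).le
    rw [setIntegral_const, smul_eq_mul] at h1
    rw [setAverage_eq, smul_eq_mul, ← div_eq_inv_mul, le_div_iff₀ hpos]
    linarith
  exact absurd (ge_of_tendsto h hlow) (not_le.2 hε)

/-- The zero set of a nonzero rigid body motion has vanishing `(d-1)`-dimensional measure. -/
theorem hausdorffMeasure_rigid_zeros {c : Fin d → ℝ} {m : Matrix (Fin d) (Fin d) ℝ}
    (hm : m.transpose = -m) (hne : ¬(c = 0 ∧ m = 0)) :
    (Measure.hausdorffMeasure ((d : ℝ) - 1) : Measure (Pt d))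
      {x | ∀ i, c i + ∑ j, m i j * x j = 0} = 0 := by
  set Z : Set (Pt d) := {x | ∀ i, c i + ∑ j, m i j * x j = 0} with hZ
  rcases Z.eq_empty_or_nonempty with h0 | hZne
  · rw [h0, measure_empty]
  have hm0 : m ≠ 0 := by
    rintro rfl
    obtain ⟨x, hx⟩ := hZne
    exact hne ⟨funext fun i => by simpa using hx i, rfl⟩
  have hanti : ∀ i j, m j i = -m i j := fun i j => by
    simpa using congrFun (congrFun hm i) j
  obtain ⟨i, j, hij⟩ : ∃ i j, m i j ≠ 0 := by
    by_contra! h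
    exact hm0 (Matrix.ext h)
  have hii : ∀ i, m i i = 0 := fun i => by linarith [hanti i i]
  let row : Fin d → Pt d →ₗ[ℝ] ℝ := fun i =>
    (∑ j, m i j • EuclideanSpace.proj j : Pt d →L[ℝ] ℝ).toLinearMap
  have hrow : ∀ i x, row i x = ∑ j, m i j * x j := fun i x => by
    simp [row]
  have hrow1 : ∀ i j t, row i (EuclideanSpace.single j t) = m i j * t := fun i j t => by
    rw [hrow]; simp
  -- Antisymmetry with `m i j ≠ 0` makes rows `i` and `j` independent. The zero set thus lies in an
  -- affine subspace of codimension two, one less than dimension `d - 1`. Surjectivity of `T` also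
  -- gives `2 ≤ d`, so the natural subtraction `d - 1` is harmless.
  let T : Pt d →ₗ[ℝ] ℝ × ℝ := (row i).prod (row j)
  have hT : LinearMap.range T = ⊤ := by
    rw [LinearMap.range_eq_top]
    rintro ⟨s, t⟩
    have hji : m j i ≠ 0 := by rw [hanti i j]; exact neg_ne_zero.2 hij
    refine ⟨EuclideanSpace.single j (s / m i j) + EuclideanSpace.single i (t / m j i), ?_⟩
    refine Prod.ext ?_ ?_
    · change row i _ = s
      rw [map_add, hrow1, hrow1, hii, zero_mul, add_zero, mul_div_cancel₀ _ hij]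
    · change row j _ = t
      rw [map_add, hrow1, hrow1, hii, zero_mul, zero_add, mul_div_cancel₀ _ hji]
  have hrank := LinearMap.finrank_range_add_finrank_ker T
  rw [hT, finrank_top, Module.finrank_prod, Module.finrank_self, finrank_euclideanSpace,
    Fintype.card_fin] at hrank
  have hspan : vectorSpan ℝ Z ≤ LinearMap.ker T := by
    refine Submodule.span_le.2 ?_
    rintro _ ⟨x, hx, y, hy, rfl⟩
    have hx' : ∀ k, row k x = -c k := fun k => by rw [hrow]; linarith [hx k]
    have hy' : ∀ k, row k y = -c k := fun k => by rw [hrow]; linarith [hy k]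
    simp [T, hx', hy']
  have hconv : Convex ℝ Z := by
    intro x hx y hy s t _ _ hst k
    have hx' : row k x = -c k := by rw [hrow]; linarith [hx k]
    have hy' : row k y = -c k := by rw [hrow]; linarith [hy k]
    rw [← hrow, map_add, map_smul, map_smul, hx', hy', smul_eq_mul, smul_eq_mul]
    linear_combination (-c k) * hst
  have hfin := Submodule.finrank_mono hspan
  have hlt : dimH Z < ((d - 1 : ℕ) : NNReal) := by
    rw [Real.Convex.dimH_eq_finrank_vectorSpan hconv hZne]
    norm_cast
    omega
  have hd : (d : ℝ) - 1 = (((d - 1 : ℕ) : NNReal) : ℝ) := by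
    rw [NNReal.coe_natCast, Nat.cast_sub (by omega), Nat.cast_one]
  rw [hd]
  exact hausdorffMeasure_of_dimH_lt hlt

/-- On the displacement spaces, the strain determines the displacement. -/
theorem IsDisplacementSpace.eq_zero_of_strain_eq_zero {V : Submodule ℝ (H1 Ω)}
    (hV : IsDisplacementSpace Ω V) (ho : IsOpen Ω) (hc : IsConnected Ω)
    (hb : Bornology.IsBounded Ω) {v : H1 Ω} (hv : v ∈ V) (h : ∀ i j, strain i j v = 0) :
    v = 0 := by
  obtain ⟨c, m, hm, hcomp, hgrad⟩ := exists_rigid_of_strain_eq_zero ho hc hb h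
  refine eq_zero_of_comp_eq_zero ho hb fun i => ?_
  cases hV with
  | dirichlet _ ΓD hclosed hsub hpos =>
    by_cases h0 : c = 0 ∧ m = 0
    · refine (Lp.eq_zero_iff_ae_eq_zero).2 ((hcomp i).trans (Eventually.of_forall fun x => ?_))
      simp [h0.1, h0.2]
    · exfalso
      refine hpos ?_
      -- Up to a null set `ΓD` lies in the zero set of the rigid motion, which is itself null; this
      -- contradicts `hpos`.
      have hae : ∀ᵐ x ∂((Measure.hausdorffMeasure ((d : ℝ) - 1) : Measure (Pt d)).restrict ΓD),
          ∀ i, c i + ∑ j, m i j * x j = 0 := by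
        rw [ae_all_iff]
        intro i
        filter_upwards [hv i, ae_restrict_mem hclosed.measurableSet] with x hx hxD
        exact eq_zero_of_average_tendsto_zero ho (by fun_prop) (hcomp i)
          (frontier_subset_closure (hsub hxD)) hx
      rw [ae_restrict_iff' hclosed.measurableSet] at hae
      refine measure_mono_null (fun x hx => ?_)
        (measure_union_null hae (hausdorffMeasure_rigid_zeros hm h0))
      by_cases hxZ : ∀ i, c i + ∑ j, m i j * x j = 0
      · exact Or.inr hxZ
      · exact Or.inl fun h1 => hxZ (h1 hx)
  | traction =>
    -- The field is itself a rigid motion, hence orthogonal to itself.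
    have h1 := hv (fun i => comp i v) ⟨c, m, hm, hcomp⟩
    simp only [real_inner_self_eq_norm_sq] at h1
    have h2 := (Finset.sum_eq_zero_iff_of_nonneg fun i _ => sq_nonneg ‖comp i v‖).1 h1 i
      (Finset.mem_univ i)
    simpa using h2
  | periodic =>
    have hvol : volume.real (unitCube d) ≠ 0 :=
      (ENNReal.toReal_pos (ho.measure_pos volume hc.nonempty).ne' hb.measure_lt_top.ne).ne'
    have hm0 : ∀ i j, m i j = 0 := by
      intro i j
      -- Testing with the periodic function `1` shows that the gradient has mean zero, so the
      -- constants `m i j` vanish; the mean-zero condition then removes `c`.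
      have h1 := hv.1 i j (fun _ => 1) ⟨contDiff_const, fun _ _ => rfl⟩
      have h2 : ∀ x : Pt d, pderiv j (fun _ => (1 : ℝ)) x = 0 := fun x => by simp [pderiv]
      simp only [h2, mul_zero, mul_one, integral_zero] at h1
      rw [integral_congr_ae (hgrad i j), setIntegral_const, smul_eq_mul] at h1
      simpa [hvol] using h1
    have hci : c i = 0 := by
      have h1 := hv.2 i
      simp only [mul_one] at h1
      rw [integral_congr_ae (hcomp i)] at h1
      simpa [hm0, hvol] using h1
    refine (Lp.eq_zero_iff_ae_eq_zero).2 ((hcomp i).trans (Eventually.of_forall fun x => ?_))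
    simp [hci, hm0]

end Kernel

/-! ### The discrete operators, spectral equivalence and the discrete Stokes problem. -/

section DiscreteForms

variable {Ω : Set (Pt d)}

theorem a_self (v : H1 Ω) : a v v = ∑ i, ∑ j, ‖strain i j v‖ ^ 2 := by
  simp [a]

theorem a_comm (u v : H1 Ω) : a u v = a v u := by
  simp only [a, LinearMap.sum_apply, LinearMap.compl₁₂_apply, innerₗ_apply_apply]
  exact Finset.sum_congr rfl fun i _ => Finset.sum_congr rfl fun j _ => real_inner_comm _ _

theorem a_self_nonneg (v : H1 Ω) : 0 ≤ a v v := by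
  rw [a_self]; positivity

/-- The divergence is the trace of the strain; Cauchy–Schwarz over the `d` diagonal entries gives
the factor `d`. -/
theorem norm_divergence_sq_le (v : H1 Ω) : ‖divergence v‖ ^ 2 ≤ d * a v v := by
  have h1 : ∀ i, strain i i v = grad i i v := fun i => by
    simp only [strain, LinearMap.smul_apply, ← two_smul ℝ, smul_smul]
    norm_num
  have h2 : ‖divergence v‖ ≤ ∑ i, ‖strain i i v‖ := by
    simp only [h1, divergence, LinearMap.sum_apply]
    exact norm_sum_le _ _
  calc ‖divergence v‖ ^ 2 ≤ (∑ i, ‖strain i i v‖) ^ 2 := pow_le_pow_left₀ (norm_nonneg _) h2 2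
    _ ≤ d * ∑ i, ‖strain i i v‖ ^ 2 := by
        simpa using sq_sum_le_card_mul_sum_sq (s := Finset.univ) (f := fun i => ‖strain i i v‖)
    _ ≤ d * a v v := by
        rw [a_self]
        gcongr with i
        exact Finset.single_le_sum (f := fun j => ‖strain i j v‖ ^ 2)
          (fun j _ => sq_nonneg _) (Finset.mem_univ i)

/-- Symmetrization does not increase the norm. This passes from `‖∇v‖` in the inf-sup condition to
the energy norm without losing any of `β`. -/
theorem sqrt_a_self_le_gradNorm (v : H1 Ω) : √(a v v) ≤ gradNorm v := by
  refine Real.sqrt_le_sqrt ?_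
  rw [a_self]
  have h1 : ∀ i j, ‖strain i j v‖ ^ 2 ≤ (‖grad i j v‖ ^ 2 + ‖grad j i v‖ ^ 2) / 2 := by
    intro i j
    have h : ‖strain i j v‖ = ‖grad i j v + grad j i v‖ / 2 := by
      simp only [strain, LinearMap.smul_apply, LinearMap.add_apply, norm_smul]
      norm_num
      ring
    rw [h]
    have h2 := norm_add_le (grad i j v) (grad j i v)
    nlinarith [norm_nonneg (grad i j v + grad j i v), sq_nonneg (‖grad i j v‖ - ‖grad j i v‖),
      pow_le_pow_left₀ (norm_nonneg _) h2 2]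
  calc ∑ i, ∑ j, ‖strain i j v‖ ^ 2
      ≤ ∑ i, ∑ j, (‖grad i j v‖ ^ 2 + ‖grad j i v‖ ^ 2) / 2 :=
        Finset.sum_le_sum fun i _ => Finset.sum_le_sum fun j _ => h1 i j
    _ = ∑ i, ∑ j, ‖grad i j v‖ ^ 2 := by
        simp only [add_div, Finset.sum_add_distrib]
        rw [Finset.sum_comm (f := fun i j => ‖grad j i v‖ ^ 2 / 2), ← Finset.sum_add_distrib]
        refine Finset.sum_congr rfl fun i _ => ?_
        rw [← Finset.sum_add_distrib]
        exact Finset.sum_congr rfl fun j _ => add_halves _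

variable (Vh : Submodule ℝ (H1 Ω)) (Qh : Submodule ℝ (L2 Ω))

/-- The form `a` on the discrete space. -/
noncomputable def discForm : Vh →ₗ[ℝ] Vh →ₗ[ℝ] ℝ := a.compl₁₂ Vh.subtype Vh.subtype

theorem discForm_self_nonneg (v : Vh) : 0 ≤ discForm Vh v v := a_self_nonneg v.1

theorem discForm_comm (u v : Vh) : discForm Vh u v = discForm Vh v u := a_comm u.1 v.1

theorem discForm_sub_left (u v w : Vh) :
    discForm Vh (u - v) w = discForm Vh u w - discForm Vh v w := by
  change a (u.1 - v.1) w.1 = a u.1 w.1 - a v.1 w.1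
  rw [LinearMap.map_sub, LinearMap.sub_apply]

/-- The discrete divergence `Π_h div : Vh → Qh`. -/
noncomputable def discDiv [FiniteDimensional ℝ Qh] : Vh →ₗ[ℝ] Qh :=
  Qh.orthogonalProjectionOnto.toLinearMap ∘ₗ divergence ∘ₗ Vh.subtype

variable [FiniteDimensional ℝ Qh]

theorem inner_discDiv (v : Vh) (q : Qh) : inner ℝ (discDiv Vh Qh v) q = b v.1 q.1 := by
  change inner ℝ (Qh.orthogonalProjectionOnto (divergence v.1)) q
    = inner ℝ (divergence v.1) (q : L2 Ω)
  rw [Submodule.inner_orthogonalProjectionOnto_eq_of_mem_right]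

/-- Since `Π_h` is an orthogonal projection, `b(v, Π_h div u) = (Π_h div u, Π_h div v)`, which
exhibits the operator as `A + λ B*B`. -/
theorem discA_apply (lam : ℝ) (u v : Vh) :
    discA Vh Qh lam u v
      = discForm Vh u v + lam * inner ℝ (discDiv Vh Qh u) (discDiv Vh Qh v) := by
  rw [real_inner_comm, inner_discDiv]
  rfl

theorem mem_discW_iff (v : Vh) : v ∈ discW Vh Qh ↔ discDiv Vh Qh v = 0 := by
  constructor
  · intro h
    rw [← inner_self_eq_zero (𝕜 := ℝ), inner_discDiv]
    exact h _ (Subtype.coe_prop _)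
  · intro h q hq
    rw [← inner_discDiv Vh Qh v ⟨q, hq⟩, h, inner_zero_left]

theorem norm_discDiv_sq_le (v : Vh) : ‖discDiv Vh Qh v‖ ^ 2 ≤ d * discForm Vh v v :=
  (pow_le_pow_left₀ (norm_nonneg _)
    (Qh.norm_orthogonalProjectionOnto_apply_le (divergence v.1)) 2).trans
    (norm_divergence_sq_le v.1)

variable {Vh Qh}

/-- Inf-sup in division-free form and for the energy norm: any energy bound `S` for `v ↦ b(v, q)` is
at least `β ‖q‖`. -/
theorem DiscreteInfSup.mul_norm_le {β : ℝ} (h : DiscreteInfSup Vh Qh β)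
    (hpos : ∀ v : Vh, v ≠ 0 → 0 < discForm Vh v v) (q : Qh) {S : ℝ} (hS : 0 ≤ S)
    (hq : ∀ v, inner ℝ q (discDiv Vh Qh v) ≤ S * √(discForm Vh v v)) : β * ‖q‖ ≤ S := by
  by_cases hq0 : q = 0
  · rw [hq0, norm_zero, mul_zero]; exact hS
  have hqn : 0 < ‖q.1‖ := norm_pos_iff.2 fun h0 => hq0 (Subtype.ext h0)
  have h1 : β ≤ S / ‖q.1‖ := by
    -- `Real.iSup_le` asks for a nonnegative bound because a real supremum over an empty family is
    -- `0`, which is the case `Vh = 0`.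
    refine (h q.1 q.2 fun h0 => hq0 (Subtype.ext h0)).trans
      (Real.iSup_le (fun v => ?_) (div_nonneg hS hqn.le))
    have hg := sqrt_a_self_le_gradNorm v.1.1
    have hg0 : 0 < gradNorm v.1.1 := (Real.sqrt_pos.2 (hpos v.1 v.2)).trans_le hg
    rw [div_le_div_iff₀ (mul_pos hg0 hqn) hqn, ← mul_assoc]
    refine mul_le_mul_of_nonneg_right ?_ hqn.le
    rw [← inner_discDiv, real_inner_comm]
    exact (hq v.1).trans (mul_le_mul_of_nonneg_left hg hS)
  rwa [le_div_iff₀ hqn] at h1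

theorem discA_pos {lam : ℝ} (hl : 0 ≤ lam) (hpos : ∀ v : Vh, v ≠ 0 → 0 < discForm Vh v v)
    (v : Vh) (hv : v ≠ 0) : 0 < discA Vh Qh lam v v := by
  rw [discA_apply, real_inner_self_eq_norm_sq]
  have := hpos v hv
  positivity

theorem apply_invOp {X : Vh →ₗ[ℝ] Module.Dual ℝ Vh} (hX : Function.Bijective X)
    (g : Module.Dual ℝ Vh) : X (invOp X g) = g := by
  rw [invOp, dif_pos hX]
  exact (LinearEquiv.ofBijective X hX).apply_symm_apply g

variable [FiniteDimensional ℝ Vh]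

omit [FiniteDimensional ℝ Qh] in
theorem isDiscProjection_discP (hpos : ∀ v : Vh, v ≠ 0 → 0 < discForm Vh v v) :
    IsDiscProjection Vh Qh (discP Vh Qh) := by
  have h : ∃ P : Vh →ₗ[ℝ] Vh, IsDiscProjection Vh Qh P := by
    obtain ⟨P, hP⟩ := exists_orthogonal_projection (H := Vh) (A := discForm Vh) hpos (discW Vh Qh)
    exact ⟨P, fun v => ⟨(hP v).1, fun w hw => (hP v).2 w hw⟩⟩
  rw [discP, dif_pos h]
  exact h.choose_spec

omit [FiniteDimensional ℝ Qh] in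
theorem isDiscProjection_iff (hpos : ∀ v : Vh, v ≠ 0 → 0 < discForm Vh v v)
    (P : Vh →ₗ[ℝ] Vh) : IsDiscProjection Vh Qh P ↔ P = discP Vh Qh := by
  have h0 := isDiscProjection_discP (Qh := Qh) hpos
  refine ⟨fun h => LinearMap.ext fun v => ?_, fun h => h ▸ h0⟩
  exact eq_of_forall_form_eq (H := Vh) (A := discForm Vh) hpos (h v).1 (h0 v).1 fun w hw =>
    ((h v).2 w hw).trans ((h0 v).2 w hw).symm

omit [FiniteDimensional ℝ Vh] in
theorem DiscreteInfSup.form_le_norm_discDiv_sq {β : ℝ} (h : DiscreteInfSup Vh Qh β) (hβ : 0 < β)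
    (hpos : ∀ v : Vh, v ≠ 0 → 0 < discForm Vh v v) {z : Vh}
    (hz : ∀ v, discDiv Vh Qh v = 0 → discForm Vh z v = 0) :
    β ^ 2 * discForm Vh z z ≤ ‖discDiv Vh Qh z‖ ^ 2 := by
  have hB : ∀ (q : Qh) (S : ℝ), 0 ≤ S →
      (∀ v, inner ℝ q (discDiv Vh Qh v) ≤ S * √(discForm Vh v v)) → β * ‖q‖ ≤ S :=
    fun q _ hS hq => h.mul_norm_le hpos q hS hq
  exact form_le_norm_sq_of_infSup (H := Vh) (Q := Qh) (A := discForm Vh) (discForm_self_nonneg Vh)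
    (discForm_comm Vh) (discDiv Vh Qh) hβ hB (z := z) hz

theorem discForm_equiv {β lam C : ℝ} (hd : 0 < d) (hβ : 0 < β) (hl : 0 ≤ lam)
    (hpos : ∀ v : Vh, v ≠ 0 → 0 < discForm Vh v v) (h : DiscreteInfSup Vh Qh β)
    (hC1 : 1 ≤ C) (hCd : d ≤ C) (hCβ : 1 ≤ C * β ^ 2) {f u : Vh}
    (hu : ∀ v, discA Vh Qh lam u v = discForm Vh f v) :
    discForm Vh f u ≤ C * (lam / (1 + lam) * discForm Vh f (discP Vh Qh f)
        + 1 / (1 + lam) * discForm Vh f f) ∧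
      lam / (1 + lam) * discForm Vh f (discP Vh Qh f) + 1 / (1 + lam) * discForm Vh f f
        ≤ C * discForm Vh f u := by
  have hP := isDiscProjection_discP (Qh := Qh) hpos f
  have hW : discDiv Vh Qh (discP Vh Qh f) = 0 := (mem_discW_iff Vh Qh _).1 hP.1
  have hPf : ∀ v, discDiv Vh Qh v = 0 → discForm Vh (discP Vh Qh f) v = discForm Vh f v :=
    fun v hv => hP.2 v ((mem_discW_iff Vh Qh v).2 hv)
  have hsol : ∀ v, discForm Vh u v + lam * inner ℝ (discDiv Vh Qh u) (discDiv Vh Qh v)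
      = discForm Vh f v := fun v => (discA_apply Vh Qh lam u v).symm.trans (hu v)
  have h1 := energy_equiv (H := Vh) (Q := Qh) (A := discForm Vh) (discForm_self_nonneg Vh)
    (discForm_comm Vh) (discDiv Vh Qh) (β := β) (D := (d : ℝ)) (lam := lam) (f := f)
    (p := discP Vh Qh f) (u := u) (C := C)
  have h2 := h1 hβ (Nat.cast_pos.2 hd) hl
  have h3 := h2 (norm_discDiv_sq_le Vh Qh)
  have h4 := h3 fun z hz => h.form_le_norm_discDiv_sq hβ hpos hz
  exact h4 hW hPf hsol hC1 hCd hCβ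

omit [FiniteDimensional ℝ Vh] in
theorem discM_apply (lam : ℝ) (g : Module.Dual ℝ Vh) :
    discM Vh Qh lam g = (lam / (1 + lam)) • discP Vh Qh (invOp (discA Vh Qh 0) g)
      + (1 / (1 + lam)) • invOp (discA Vh Qh 0) g := rfl

set_option maxHeartbeats 1000000 in
-- With `f = A_h⁻¹ g` one has `g = a(f, ·)`, so both quadratic forms in `g` become energies and
-- `discForm_equiv` compares them.
theorem spectrallyEquivalent_discM {β lam C : ℝ} (hd : 0 < d) (hβ : 0 < β) (hl : 0 ≤ lam)
    (hpos : ∀ v : Vh, v ≠ 0 → 0 < discForm Vh v v) (h : DiscreteInfSup Vh Qh β)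
    (hC1 : 1 ≤ C) (hCd : d ≤ C) (hCβ : 1 ≤ C * β ^ 2) :
    SpectrallyEquivalent C (invOp (discA Vh Qh lam)) (discM Vh Qh lam) := by
  have key : ∀ g : Module.Dual ℝ Vh,
      g (invOp (discA Vh Qh lam) g) ≤ C * g (discM Vh Qh lam g) ∧
        g (discM Vh Qh lam g) ≤ C * g (invOp (discA Vh Qh lam) g) := by
    intro g
    have hAu : discA Vh Qh lam (invOp (discA Vh Qh lam) g) = g :=
      apply_invOp (bijective_of_posDef (H := Vh) (discA_pos hl hpos)) g
    have hAf : discA Vh Qh 0 (invOp (discA Vh Qh 0) g) = g :=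
      apply_invOp (bijective_of_posDef (H := Vh) (discA_pos le_rfl hpos)) g
    rw [discM_apply]
    generalize invOp (discA Vh Qh lam) g = u at *
    generalize invOp (discA Vh Qh 0) g = f at *
    have hg : ∀ v, g v = discForm Vh f v := fun v => by
      rw [← hAf, discA_apply, zero_mul, add_zero]
    have hM := dual_apply_combination (H := Vh) g (lam / (1 + lam)) (1 / (1 + lam)) (discP Vh Qh f) f
    rw [hg (discP Vh Qh f), hg f] at hM
    rw [hM, hg]
    exact discForm_equiv hd hβ hl hpos h hC1 hCd hCβ fun v => by rw [hAu, hg]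
  exact ⟨fun g => (key g).1, fun g => (key g).2⟩

/-- The functional `a(v - P_h v, ·)` vanishes on `W_h = ker B`, so it is represented by a pressure
through `B`. Testing with `W_h` determines the velocity, and inf-sup determines the pressure. -/
theorem exists_pressure {β : ℝ} (hβ : 0 < β)
    (hpos : ∀ v : Vh, v ≠ 0 → 0 < discForm Vh v v) (h : DiscreteInfSup Vh Qh β) (v : Vh) :
    ∃ p : Qh, ∀ (v₀ : Vh) (q : Qh),
      IsDiscStokesSolution Vh Qh v v₀ q ↔ v₀ = discP Vh Qh v ∧ q = p := by
  have hP := isDiscProjection_discP (Qh := Qh) hpos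
  obtain ⟨p, hp⟩ := exists_inner_eq_of_vanish_on_ker (H := Vh) (Q := Qh) (discDiv Vh Qh)
    (discForm Vh (v - discP Vh Qh v)) fun w hw => by
      rw [discForm_sub_left, sub_eq_zero]
      exact ((hP v).2 w ((mem_discW_iff Vh Qh w).2 hw)).symm
  have hp' : ∀ w : Vh, a (discP Vh Qh v).1 w.1 + b w.1 p.1 = a v.1 w.1 := by
    intro w
    have h1 := hp w
    rw [discForm_sub_left, real_inner_comm, inner_discDiv] at h1
    rw [← h1]
    exact add_sub_cancel _ _
  refine ⟨p, fun v₀ q => ⟨fun hsol => ?_, ?_⟩⟩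
  · have hv₀ : v₀ ∈ discW Vh Qh := fun q hq => hsol.2 ⟨q, hq⟩
    have hv : v₀ = discP Vh Qh v := by
      refine eq_of_forall_form_eq (H := Vh) (A := discForm Vh) hpos hv₀ (hP v).1 fun w hw => ?_
      have h1 := hsol.1 w
      rw [hw q.1 q.2, add_zero] at h1
      exact h1.trans ((hP v).2 w hw).symm
    refine ⟨hv, sub_eq_zero.1 (norm_le_zero_iff.1 ?_)⟩
    -- The difference of two pressures annihilates every discrete divergence, so inf-sup applies
    -- with `S = 0`.
    have hle : β * ‖q - p‖ ≤ 0 := by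
      refine h.mul_norm_le hpos (q - p) le_rfl fun w => ?_
      have h1 := hsol.1 w
      rw [hv, ← hp' w] at h1
      rw [inner_sub_left, real_inner_comm, inner_discDiv, real_inner_comm, inner_discDiv,
        zero_mul]
      linarith
    exact nonpos_of_mul_nonpos_right hle hβ
  · rintro ⟨rfl, rfl⟩
    exact ⟨hp', fun q => (hP v).1 q.1 q.2⟩

end DiscreteForms

end Elasticity

/-! ### Assembly of the theorem. -/

theorem mainTheorem3 (d : ℕ) (hd : d = 2 ∨ d = 3)
    (Ω : Set (Elasticity.Pt d)) (hΩ : Elasticity.IsLipschitzDomain Ω)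
    (β : ℝ) (hβ : 0 < β) :
    ∃ C : ℝ, 0 < C ∧
      ∀ (V : Submodule ℝ (Elasticity.H1 Ω)), Elasticity.IsDisplacementSpace Ω V →
      ∀ (Vh : Submodule ℝ (Elasticity.H1 Ω)) (Qh : Submodule ℝ (Elasticity.L2 Ω))
        [FiniteDimensional ℝ Vh] [FiniteDimensional ℝ Qh],
        Vh ≤ V → Elasticity.DiscreteInfSup Vh Qh β →
        -- the discrete operators are invertible, and are given by `a_λ` if `div Vh ⊆ Qh`
        (∀ lam : ℝ, 0 ≤ lam → Function.Bijective (Elasticity.discA Vh Qh lam)) ∧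
        ((∀ u : Vh, Elasticity.divergence u.1 ∈ Qh) → ∀ (lam : ℝ) (u v : Vh),
          Elasticity.discA Vh Qh lam u v
            = Elasticity.a u.1 v.1 + lam * Elasticity.b v.1 (Elasticity.divergence u.1)) ∧
        -- the `a`-orthogonal projection onto `W_h` exists and is unique
        (∀ P : Vh →ₗ[ℝ] Vh,
          Elasticity.IsDiscProjection Vh Qh P ↔ P = Elasticity.discP Vh Qh) ∧
        -- spectral equivalence, uniformly in `λ ≥ 0`
        (∀ lam : ℝ, 0 ≤ lam →
          Elasticity.SpectrallyEquivalent C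
            (Elasticity.invOp (Elasticity.discA Vh Qh lam)) (Elasticity.discM Vh Qh lam)) ∧
        -- the discrete Stokes problem has exactly one solution, with velocity `P_h v`
        ∀ v : Vh, ∃ p : Qh, ∀ (v₀ : Vh) (q : Qh),
          Elasticity.IsDiscStokesSolution Vh Qh v v₀ q
            ↔ v₀ = Elasticity.discP Vh Qh v ∧ q = p := by
  have hd0 : 0 < d := by omega
  have hβ2 : 0 < β ^ 2 := by positivity
  have hC : 0 ≤ 1 / β ^ 2 := by positivity
  have hd1 : (0 : ℝ) ≤ d := d.cast_nonneg
  -- The three summands serve the requirements `d ≤ C`, `1 ≤ C` and `1 ≤ C * β ^ 2` of the energy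
  -- comparison.
  refine ⟨d + 1 + 1 / β ^ 2, by positivity, ?_⟩
  intro V hV Vh Qh _ _ hle h
  have hpos : ∀ v : Vh, v ≠ 0 → 0 < Elasticity.discForm Vh v v := by
    intro v hv
    refine lt_of_le_of_ne (Elasticity.a_self_nonneg v.1) fun h0 => hv (Subtype.ext ?_)
    exact hV.eq_zero_of_strain_eq_zero hΩ.isOpen hΩ.isConnected hΩ.isBounded (hle v.2)
      (Elasticity.strain_eq_zero_of_a_self h0.symm)
  refine ⟨fun lam hl => Elasticity.bijective_of_posDef (H := Vh) (Elasticity.discA_pos hl hpos),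
    fun hdiv lam u v => ?_, Elasticity.isDiscProjection_iff hpos, fun lam hl =>
    Elasticity.spectrallyEquivalent_discM hd0 hβ hl hpos h (by linarith) (by linarith) ?_,
    Elasticity.exists_pressure hβ hpos h⟩
  · change Elasticity.a u.1 v.1
      + lam * Elasticity.b v.1 (Qh.starProjection (Elasticity.divergence u.1)) = _
    rw [Submodule.starProjection_eq_self_iff.2 (hdiv u)]
  · rw [add_mul, one_div, inv_mul_cancel₀ hβ2.ne']
    nlinarith
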